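/- Let $p$ be a prime number, let $H$ be a (topologically) finitely generated pro-$p$-group, and let $k$ be a field of characteristic $p$. For a $k$-vector space $V$ and a profinite set $X$, let $V[[X]]$ denote the $k$-vector space of all finitely additive $V$-valued measures defined on the open-closed subsets of $X$; there is a natural isomorphism $V[[X\times Y]]\simeq V[[X]][[Y]]$, $\nu\mapsto\bigl(B\mapsto(A\mapsto\nu(A\times B))\bigr)$. An \emph{$H$-contramodule over $k$} is a $k$-vector space $P$ with a $k$-linear map $\pi_P\colon P[[H]]\to P$ such that (i) the two maps $P[[H]][[H]]\simeq P[[H\times H]]\rightrightarrows P[[H]]$, one given by pushforward of measures along the multiplication $H\times H\to H$ and the other induced by $\pi_P$, have equal compositions with $\pi_P$; (ii) $\pi_P$ sends the point measure at the unit element of $H$ with value $x$ to $x$, for every $x\in P$. Morphisms $P\to Q$ are the $k$-linear maps $f$ with $f\circ\pi_P=\pi_Q\circ f_*$, where $f_*\colon P[[H]]\to Q[[H]]$ is the map induced by $f$. Denote the category of $H$-contramodules over $k$ by $H\text{-contra}_k$. For an abstract group $\Gamma$, denote by $\Gamma\text{-mod}_k$ the category of $k$-vector spaces with a $k$-linear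 action of $\Gamma$. An $H$-contramodule $P$ has an underlying $H$-module structure in which $h(x)$ is the image under $\pi_P$ of the point measure at $h^{-1}$ with value $x$. Then the forgetful functor $H\text{-contra}_k\to H\text{-mod}_k$ is fully faithful. Moreover, for any dense subgroup $H'\subset H$, the forgetful functor $H\text{-contra}_k\to H'\text{-mod}_k$ is fully faithful. -/

import Mathlib

open CategoryTheory TopologicalSpace

universe w u v

namespace Contra

/-- `V[[X]]`: the `k`-vector space of finitely additive `V`-valued measures defined on
the open-closed subsets of the topological space `X`. (Additivity for the pair `⊥, ⊥` gives
`μ ⊥ = 0`.) -/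
def Meas (k : Type w) [Field k] (X : Type u) [TopologicalSpace X]
    (V : Type v) [AddCommGroup V] [Module k V] : Submodule k (Clopens X → V) where
  carrier := {μ | ∀ A B : Clopens X, Disjoint A B → μ (A ⊔ B) = μ A + μ B}
  add_mem' := by
    intro μ ν hμ hν A B h
    simp only [Pi.add_apply, hμ A B h, hν A B h]
    abel
  zero_mem' := by
    intro A B _
    simp
  smul_mem' := by
    intro c μ hμ A B h
    simp only [Pi.smul_apply, hμ A B h, smul_add]

section Measures

variable {k : Type w} [Field k] {X Y : Type*} [TopologicalSpace X] [TopologicalSpace Y]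
  {V W : Type*} [AddCommGroup V] [Module k V] [AddCommGroup W] [Module k W]

/-- The preimage of a clopen set under a continuous map. -/
def clopenPreimage (f : C(X, Y)) (A : Clopens Y) : Clopens X :=
  ⟨f ⁻¹' (A : Set Y), A.isClopen.preimage f.continuous⟩

/-- Pushforward of measures along a continuous map: `(f_* μ)(A) = μ(f⁻¹ A)`. -/
def pushforward (f : C(X, Y)) : Meas k X V →ₗ[k] Meas k Y V where
  toFun μ := ⟨fun A => μ.1 (clopenPreimage f A), by
    intro A B h
    refine μ.2 (clopenPreimage f A) (clopenPreimage f B) ?_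
    rw [← Clopens.coe_disjoint] at h ⊢
    exact h.preimage f⟩
  map_add' _ _ := rfl
  map_smul' _ _ := rfl

/-- The map `V[[X]] → W[[X]]` induced by a linear map `g : V → W`: `A ↦ g (μ A)`. -/
def mapCoeff (g : V →ₗ[k] W) : Meas k X V →ₗ[k] Meas k X W where
  toFun μ := ⟨fun A => g (μ.1 A), by
    intro A B h
    simp only [μ.2 A B h, map_add]⟩
  map_add' μ ν := by
    ext A
    exact g.map_add (μ.1 A) (ν.1 A)
  map_smul' c μ := by
    ext A
    exact g.map_smul c (μ.1 A)

/-- The natural map `V[[X × Y]] → V[[X]][[Y]]`, `ν ↦ (B ↦ (A ↦ ν (A × B)))`; for profinite `X`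
and `Y` it is an isomorphism. -/
def curry : Meas k (X × Y) V →ₗ[k] Meas k Y (Meas k X V) where
  toFun ν := ⟨fun B => ⟨fun A => ν.1 (A ×ˢ B), by
      intro A A' h
      have hd : Disjoint (A ×ˢ B) (A' ×ˢ B) := by
        rw [← Clopens.coe_disjoint] at h ⊢
        exact Set.Disjoint.set_prod_left h _ _
      rw [← ν.2 _ _ hd]
      exact congrArg ν.1 (Clopens.ext Set.union_prod)⟩, by
    intro B B' h
    ext A
    have hd : Disjoint (A ×ˢ B) (A ×ˢ B') := by
      rw [← Clopens.coe_disjoint] at h ⊢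
      exact Set.Disjoint.set_prod_right h _ _
    refine Eq.trans ?_ (ν.2 _ _ hd)
    exact congrArg ν.1 (Clopens.ext Set.prod_union)⟩
  map_add' _ _ := rfl
  map_smul' _ _ := rfl

open Classical in
/-- The point measure at `x` with value `a`: it sends `A` to `a` if `x ∈ A` and to `0`
otherwise. -/
noncomputable def pointMeas (x : X) : V →ₗ[k] Meas k X V where
  toFun a := ⟨fun A => if x ∈ A then a else 0, by
    intro A B h
    have hm : x ∈ A ⊔ B ↔ x ∈ A ∨ x ∈ B := Iff.rfl
    by_cases hA : x ∈ A
    · have hB : x ∉ B := fun hB =>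
        Set.disjoint_left.1 (Clopens.coe_disjoint.2 h) hA hB
      simp [hm, hA, hB]
    · simp [hm, hA]⟩
  map_add' a b := by
    ext A
    by_cases hA : x ∈ A <;> simp [hA]
  map_smul' c a := by
    ext A
    by_cases hA : x ∈ A <;> simp [hA]

theorem pushforward_pointMeas (f : C(X, Y)) (x : X) (a : V) :
    pushforward f (pointMeas (k := k) x a) = pointMeas (f x) a := rfl

theorem mapCoeff_pointMeas (g : V →ₗ[k] W) (x : X) (a : V) :
    mapCoeff g (pointMeas (k := k) x a) = pointMeas x (g a) := by
  ext A
  by_cases hA : x ∈ A <;> simp [mapCoeff, pointMeas, hA]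

theorem curry_pointMeas (x : X) (y : Y) (a : V) :
    curry (pointMeas (k := k) (x, y) a) = pointMeas y (pointMeas x a) := by
  ext B A
  by_cases hB : y ∈ B <;> by_cases hA : x ∈ A <;> simp [curry, pointMeas, hA, hB]

end Measures

/-- The multiplication map `H × H → H` as a continuous map. -/
def mulMap (H : Type u) [Group H] [TopologicalSpace H] [IsTopologicalGroup H] : C(H × H, H) :=
  ⟨fun x => x.1 * x.2, continuous_mul⟩

/-- An `H`-contramodule over `k` (for a profinite group `H`): a `k`-vector space `P` with
a `k`-linear contraaction map `π : P[[H]] → P` satisfying contraassociativity and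
contraunitality. -/
structure HContra (k : Type w) [Field k] (H : Type u) [Group H] [TopologicalSpace H]
    [IsTopologicalGroup H] where
  carrier : Type v
  [addCommGroup : AddCommGroup carrier]
  [module : Module k carrier]
  /-- the contraaction map -/
  π : Meas k H carrier →ₗ[k] carrier
  /-- The two maps `P[[H]][[H]] ≃ P[[H × H]] ⇉ P[[H]]`, the pushforward along the multiplication
  and the one induced by `π`, have equal compositions with `π`. -/
  contraassoc : ∀ ν : Meas k (H × H) carrier,
    π (pushforward (mulMap H) ν) = π (mapCoeff π (curry ν))
  contraunit : ∀ a : carrier, π (pointMeas 1 a) = a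

namespace HContra

attribute [instance] HContra.addCommGroup HContra.module

variable {k : Type w} [Field k] {H : Type u} [Group H] [TopologicalSpace H] [IsTopologicalGroup H]

/-- Morphisms of contramodules: `k`-linear maps commuting with the contraactions. -/
@[ext]
structure Hom (P Q : HContra.{w, u, v} k H) where
  toLinearMap : P.carrier →ₗ[k] Q.carrier
  comm : ∀ μ : Meas k H P.carrier, toLinearMap (P.π μ) = Q.π (mapCoeff toLinearMap μ)

/-- The category of `H`-contramodules over `k`. -/
instance : Category (HContra.{w, u, v} k H) where
  Hom P Q := Hom P Q
  id P := ⟨LinearMap.id, fun _ => rfl⟩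
  comp f g := ⟨g.toLinearMap ∘ₗ f.toLinearMap, fun μ => by
    rw [LinearMap.comp_apply, f.comm, g.comm]
    rfl⟩

/-- The underlying action of `H` on a contramodule: `h` sends `a` to the image under the
contraaction of the point measure at `h⁻¹` with value `a`. -/
noncomputable def action (P : HContra.{w, u, v} k H) : Representation k H P.carrier where
  toFun h := P.π ∘ₗ pointMeas h⁻¹
  map_one' := by
    ext a
    simpa using P.contraunit a
  map_mul' g h := by
    ext a
    have key := P.contraassoc (pointMeas (h⁻¹, g⁻¹) a)
    rw [pushforward_pointMeas, curry_pointMeas, mapCoeff_pointMeas] at key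
    simpa [mulMap] using key

variable (k H) in
/-- The forgetful functor from `H`-contramodules over `k` to `H`-modules over `k`. -/
noncomputable def forgetToRep : HContra.{w, u, v} k H ⥤ Rep.{v} k H where
  obj P := Rep.of P.action
  map {P Q} f := Rep.ofHom ⟨f.toLinearMap, fun h => by
    ext a
    have key := f.comm (pointMeas h⁻¹ a)
    rw [mapCoeff_pointMeas] at key
    exact key⟩
  map_id _ := rfl
  map_comp _ _ := rfl

variable (k) in
/-- The forgetful functor from `H`-contramodules over `k` to `H'`-modules over `k`, for
an (abstract) subgroup `H'` of `H`. -/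
noncomputable def forgetToSubgroupRep (H' : Subgroup H) : HContra.{w, u, v} k H ⥤ Rep.{v} k H' :=
  forgetToRep k H ⋙ Rep.resFunctor H'.subtype

end HContra

/-- A profinite group is a pro-`p`-group if every open normal subgroup has index a power
of `p`. -/
def IsProP (p : ℕ) (H : Type u) [Group H] [TopologicalSpace H] : Prop :=
  ∀ U : Subgroup H, U.Normal → IsOpen (U : Set H) → ∃ n : ℕ, U.index = p ^ n

/-- `H` is finitely generated as a topological group: some finite subset generates a dense
subgroup. -/
def IsTopFG (H : Type u) [Group H] [TopologicalSpace H] : Prop :=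
  ∃ S : Finset H, Dense (Subgroup.closure (S : Set H) : Set H)

end Contra

/-! Only fullness needs an argument. Let `f : P → Q` be linear and commute with a dense subgroup,
and let δ(μ) = f(π μ) − π(f_* μ) be its failure to be a contramodule morphism.

The continuous characters to ℤ/p are finite in number and detect generation, so the dense subgroup
contains finitely many topological generators h_i (`exists_generators_mem_of_dense`). A locally
constant function invariant under right translation by all h_i is constant; dually, every measure is
a point measure at 1 plus a finite sum of differences ν_i h_i − ν_i
(`Meas.exists_eq_pointMeas_add_sum`). Put T_i x = π(point measure at h_i with value x) − x. Since δ
kills point measures at 1 and is compatible with right translation by h_i, δ(μ) = Σ T_i δ(ν_i).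
Iterating gives elements e(w), indexed by words, with e(w) = Σ T_i e(iw) and e(∅) = δ(μ).

A Nakayama argument (`eq_zero_of_forall_eq_sum`) then gives e(∅) = 0. The augmentation ideal of
𝔽_p[G] is nilpotent for a finite p-group G, so the series Σ_w (h_{i₁} − 1)⋯(h_{iₙ} − 1) e(w) defines
a measure (`exists_forall_augWord_eq_zero`). Contraassociativity identifies the image of this
measure under π with that of its part over nonempty words, leaving e(∅) = 0. -/

open scoped Topology

namespace Contra

/-! ### Finite quotients of a profinite group -/

section Group

variable {H : Type*} [Group H] [TopologicalSpace H]

/-- A locally constant function on a profinite group is invariant under left translations by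
some open normal subgroup. -/
theorem exists_openNormalSubgroup_forall_mul_eq [IsTopologicalGroup H] [CompactSpace H]
    [TotallyDisconnectedSpace H] {T : Type*} {f : H → T}
    (hf : IsLocallyConstant f) :
    ∃ N : OpenNormalSubgroup H, ∀ n ∈ N, ∀ y, f (n * y) = f y := by
  -- Compactness of `H` makes the neighbourhood of 1 uniform in `y`.
  have h1 : ∀ᶠ g in 𝓝 (1 : H), ∀ y ∈ (Set.univ : Set H), f (g * y) = f y := by
    refine isCompact_univ.eventually_forall_of_forall_eventually fun y _ => ?_
    have ho : IsOpen {z : H × H | f (z.1 * z.2) = f z.2} := by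
      have hl : IsLocallyConstant fun z : H × H => (f (z.1 * z.2), f z.2) :=
        (hf.comp_continuous continuous_mul).prodMk (hf.comp_continuous continuous_snd)
      exact hl {q | q.1 = q.2}
    exact ho.mem_nhds (by simp)
  obtain ⟨W, hW, hWo, h1W⟩ := mem_nhds_iff.1 h1
  obtain ⟨N, hN⟩ :=
    ProfiniteGrp.exist_openNormalSubgroup_sub_open_nhds_of_one hWo h1W
  exact ⟨N, fun n hn y => hW (hN hn) y trivial⟩

theorem IsProP.isPGroup_quotient {p : ℕ} (hH : IsProP p H) (U : Subgroup H) [hn : U.Normal]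
    (hU : IsOpen (U : Set H)) : IsPGroup p (H ⧸ U) := by
  obtain ⟨n, h⟩ := hH U hn hU
  exact IsPGroup.of_card (n := n) (by rw [← h]; rfl)

end Group

/-! ### Nilpotency of iterated differences over a p-group -/

section AugWord

variable {H ι R : Type*} [Group H] [AddCommGroup R]

/-- The difference operator `φ ↦ (y ↦ φ (g y) - φ y)`. -/
def leftDiff (g : H) : (H → R) →+ (H → R) where
  toFun φ y := φ (g * y) - φ y
  map_zero' := by ext; simp
  map_add' φ ψ := by ext; simp; abel

/-- The value at `1` of the iterated differences of a function along a word. -/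
def augWord (h : ι → H) : List ι → (H → R) →+ R
  | [] => Pi.evalAddMonoidHom _ 1
  | i :: w => (augWord h w).comp (leftDiff (h i))

/-- In the semidirect product, the difference of `c` along `g` is a commutator of `c` with `g⁻¹`, so
each letter descends one step of the lower central series; `n` counts the steps already made. -/
theorem augWord_comp_mk_eq_zero (U : Subgroup H) [U.Normal] (h : ι → H) :
    ∀ (w : List ι) (n : ℕ) (c : H ⧸ U → Multiplicative R),
      (SemidirectProduct.inl c :
        (H ⧸ U → Multiplicative R) ⋊[mulAutArrow] (H ⧸ U)) ∈
          Subgroup.lowerCentralSeries ⊤ n →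
      Subgroup.lowerCentralSeries
        (⊤ : Subgroup ((H ⧸ U → Multiplicative R) ⋊[mulAutArrow] (H ⧸ U)))
        (n + w.length) = ⊥ →
      augWord h w (fun y => (c (y : H ⧸ U)).toAdd) = 0
  | [], n, c, hc, hb => by
    rw [List.length_nil, add_zero] at hb
    rw [hb, Subgroup.mem_bot] at hc
    have : c = 1 := SemidirectProduct.inl_injective (by simpa using hc)
    subst this
    exact map_zero _
  | i :: w, n, c, hc, hb => by
    let g : H ⧸ U := h i
    have hmem : (SemidirectProduct.inl (mulAutArrow g⁻¹ c * c⁻¹) :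
        (H ⧸ U → Multiplicative R) ⋊[mulAutArrow] (H ⧸ U)) ∈
          Subgroup.lowerCentralSeries ⊤ (n + 1) := by
      have h1 := Subgroup.commutator_mem_commutator hc
        (Subgroup.mem_top (SemidirectProduct.inr g⁻¹ :
          (H ⧸ U → Multiplicative R) ⋊[mulAutArrow] (H ⧸ U)))
      have h2 := inv_mem h1
      rw [commutatorElement_inv, commutatorElement_def] at h2
      rw [Subgroup.lowerCentralSeries_succ, map_mul, SemidirectProduct.inl_aut]
      simpa using h2
    have key := augWord_comp_mk_eq_zero U h w (n + 1) _ hmem (by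
      rw [← hb, List.length_cons]; congr 1; omega)
    rw [← key]
    change augWord h w _ = _
    congr 1
    ext y
    have hy : (mulAutArrow g⁻¹ c) (y : H ⧸ U) = c (g⁻¹⁻¹ * (y : H ⧸ U)) := rfl
    rw [Pi.mul_apply, hy, inv_inv, toAdd_mul, Pi.inv_apply, toAdd_inv, ← sub_eq_add_neg]
    rfl

end AugWord

section Vanish

variable {H : Type*} [Group H] [TopologicalSpace H] [IsTopologicalGroup H]
  [CompactSpace H] [TotallyDisconnectedSpace H]

/-- Coefficients in `ZMod p` make the semidirect product over a finite quotient a finite p-group,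
hence nilpotent. -/
theorem exists_forall_augWord_eq_zero {p : ℕ} [Fact p.Prime] (hH : IsProP p H) {ι : Type*}
    (h : ι → H) {φ : H → ZMod p} (hφ : IsLocallyConstant φ) :
    ∃ n : ℕ, ∀ w : List ι, n ≤ w.length → augWord h w φ = 0 := by
  obtain ⟨N, hN⟩ := exists_openNormalSubgroup_forall_mul_eq hφ
  let U : Subgroup H := N.toSubgroup
  have hfin : Finite (H ⧸ U) := Subgroup.quotient_finite_of_isOpen U N.isOpen'
  have hp := hH.isPGroup_quotient U N.isOpen'
  have hG : IsPGroup p ((H ⧸ U → Multiplicative (ZMod p)) ⋊[mulAutArrow] (H ⧸ U)) := by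
    obtain ⟨a, ha⟩ := IsPGroup.iff_card.1 hp
    refine IsPGroup.of_card (n := p ^ a + a) ?_
    rw [SemidirectProduct.card, Nat.card_fun, ha, pow_add]
    simp
  have hfin2 : Finite ((H ⧸ U → Multiplicative (ZMod p)) ⋊[mulAutArrow] (H ⧸ U)) :=
    Finite.of_equiv _ SemidirectProduct.equivProd.symm
  obtain ⟨n, hn⟩ := Subgroup.nilpotent_iff_lowerCentralSeries.1 hG.isNilpotent
  refine ⟨n, fun w hw => ?_⟩
  have hlift : ∀ a b : H, QuotientGroup.leftRel U a b → φ a = φ b := by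
    intro a b hab
    rw [QuotientGroup.leftRel_apply] at hab
    -- The invariance is under left translations while the quotient is by right ones; normality
    -- exchanges them.
    have := hN (b * a⁻¹) (by
      have h1 := Subgroup.Normal.conj_mem (inferInstanceAs U.Normal) _ hab a
      rw [← mul_assoc, mul_inv_cancel, one_mul] at h1
      exact h1) a
    simpa using this.symm
  have := augWord_comp_mk_eq_zero U h w 0
    (fun x => Multiplicative.ofAdd (Quotient.lift φ hlift x)) (by simp)
    (by rw [zero_add, eq_bot_iff, ← hn]; exact Subgroup.lowerCentralSeries_antitone _ hw)
  exact this

end Vanish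

/-! ### Topological generators and characters of order p -/

section Generators

variable {H : Type*} [Group H] [TopologicalSpace H] [IsTopologicalGroup H]

/-- Such a homomorphism is determined by its values on a finite generating set: the locus where two
of them agree is an open, hence closed, subgroup. -/
theorem finite_setOf_isOpen_ker {A : Type*} [Group A] [Finite A] (hfg : IsTopFG H) :
    {χ : H →* A | IsOpen (χ.ker : Set H)}.Finite := by
  obtain ⟨S, hS⟩ := hfg
  refine Set.Finite.of_injOn (f := fun χ : H →* A => fun s : S => χ s) (t := Set.univ)
    (fun _ _ => trivial) ?_ Set.finite_univ
  intro χ hχ ψ hψ hE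
  have hle : Subgroup.closure (S : Set H) ≤ χ.eqLocus ψ :=
    (Subgroup.closure_le _).2 fun s hs => congrFun hE ⟨s, hs⟩
  have ho : IsOpen ((χ.eqLocus ψ : Subgroup H) : Set H) := by
    refine Subgroup.isOpen_mono (H₁ := χ.ker ⊓ ψ.ker) ?_ (hχ.inter hψ)
    rintro x ⟨h1, h2⟩
    exact (MonoidHom.mem_ker.1 h1).trans (MonoidHom.mem_ker.1 h2).symm
  have hc := Subgroup.isClosed_of_isOpen _ ho
  ext x
  exact hc.closure_subset_iff.2 hle (hS x)

/-- A proper subgroup of a finite p-group lies in one of index p, which is normal because p is the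
least prime factor of the order. -/
theorem exists_monoidHom_of_lt_top {G : Type*} [Group G] [Finite G] {p : ℕ} [Fact p.Prime]
    (hG : IsPGroup p G) {M : Subgroup G} (hM : M ≠ ⊤) :
    ∃ χ : G →* Multiplicative (ZMod p), M ≤ χ.ker ∧ χ.ker ≠ ⊤ := by
  have hp := Fact.out (p := p.Prime)
  obtain ⟨m, hm⟩ := IsPGroup.iff_card.1 hG
  obtain ⟨n, hn⟩ := IsPGroup.iff_card.1 (hG.to_subgroup M)
  have hnm : n < m := by
    rw [← Nat.pow_lt_pow_iff_right hp.one_lt, ← hn, ← hm]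
    exact lt_of_le_of_ne (Subgroup.card_le_card_group M)
      fun h => hM (Subgroup.eq_top_of_card_eq M h)
  obtain ⟨K, hK, hMK⟩ := Sylow.exists_subgroup_card_pow_prime_le p (m := m - 1)
    (by rw [hm]; exact pow_dvd_pow _ (by omega)) M hn (by omega)
  have hidx : K.index = p := by
    have h1 := K.card_mul_index
    rw [hK, hm] at h1
    have h2 : p ^ m = p ^ (m - 1) * p := by rw [← pow_succ]; congr 1; omega
    rw [h2] at h1
    exact Nat.eq_of_mul_eq_mul_left (pow_pos hp.pos _) h1
  have hnormal : K.Normal := by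
    apply Subgroup.normal_of_index_eq_minFac_card
    rw [hidx, hm, hp.pow_minFac (by omega)]
  let e : G ⧸ K ≃* Multiplicative (ZMod p) :=
    mulEquivOfPrimeCardEq (p := p) hidx (by simp)
  have hker : (e.toMonoidHom.comp (QuotientGroup.mk' K)).ker = K := by
    ext x
    simp
  refine ⟨e.toMonoidHom.comp (QuotientGroup.mk' K), hMK.trans hker.ge, ?_⟩
  rw [hker]
  rintro rfl
  rw [Subgroup.index_top] at hidx
  exact hp.one_lt.ne hidx

variable [CompactSpace H] [TotallyDisconnectedSpace H]

theorem IsProP.exists_monoidHom {p : ℕ} [Fact p.Prime] (hH : IsProP p H) {M : Subgroup H}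
    (hMo : IsOpen (M : Set H)) (hM : M ≠ ⊤) :
    ∃ χ : H →* Multiplicative (ZMod p), IsOpen (χ.ker : Set H) ∧ M ≤ χ.ker ∧ χ.ker ≠ ⊤ := by
  obtain ⟨N, hN⟩ :=
    ProfiniteGrp.exist_openNormalSubgroup_sub_open_nhds_of_one hMo M.one_mem
  let U : Subgroup H := N.toSubgroup
  have hUM : U ≤ M := hN
  have hfin : Finite (H ⧸ U) := Subgroup.quotient_finite_of_isOpen U N.isOpen'
  have hcm : (M.map (QuotientGroup.mk' U)).comap (QuotientGroup.mk' U) = M := by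
    rw [Subgroup.comap_map_eq, QuotientGroup.ker_mk', sup_eq_left.2 hUM]
  obtain ⟨χ, h1, h2⟩ := exists_monoidHom_of_lt_top (hH.isPGroup_quotient U N.isOpen')
    (M := M.map (QuotientGroup.mk' U)) (by
      intro h
      rw [h, Subgroup.comap_top] at hcm
      exact hM hcm.symm)
  have hle : M ≤ (χ.comp (QuotientGroup.mk' U)).ker := fun x hx =>
    h1 (Subgroup.mem_map_of_mem _ hx)
  refine ⟨χ.comp (QuotientGroup.mk' U), Subgroup.isOpen_mono hle hMo, hle, fun h => h2 ?_⟩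
  rw [eq_top_iff]
  intro x _
  obtain ⟨y, rfl⟩ := QuotientGroup.mk'_surjective U x
  have : y ∈ (χ.comp (QuotientGroup.mk' U)).ker := h ▸ Subgroup.mem_top y
  exact this

/-- A dense subgroup of a finitely generated pro-`p`-group `H` contains a finite set of
topological generators of `H`. -/
theorem exists_generators_mem_of_dense {p : ℕ} [Fact p.Prime] (hH : IsProP p H)
    (hfg : IsTopFG H) {H' : Subgroup H} (hd : Dense (H' : Set H)) :
    ∃ (S : Finset H) (h : S → H), (∀ s, h s ∈ H') ∧
      ∀ M : Subgroup H, IsOpen (M : Set H) → (∀ s, h s ∈ M) → M = ⊤ := by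
  have hX := finite_setOf_isOpen_ker (A := Multiplicative (ZMod p)) hfg
  obtain ⟨S, hS⟩ := hfg
  have hex : ∀ s : S, ∃ g ∈ H', ∀ χ : H →* Multiplicative (ZMod p),
      IsOpen (χ.ker : Set H) → χ g = χ s := by
    intro s
    -- Finiteness of the set of characters makes this intersection open, so that it meets `H'`.
    have ho : IsOpen (⋂ χ ∈ {χ : H →* Multiplicative (ZMod p) | IsOpen (χ.ker : Set H)},
        {g : H | χ g = χ s}) := by
      refine hX.isOpen_biInter fun χ hχ => ?_
      have : {g : H | χ g = χ s} = (fun g => (s : H)⁻¹ * g) ⁻¹' (χ.ker : Set H) := by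
        ext g
        simp [MonoidHom.mem_ker, inv_mul_eq_one, eq_comm (a := χ g)]
      rw [this]
      exact hχ.preimage (continuous_const_mul _)
    obtain ⟨g, hg, hg'⟩ := hd.inter_open_nonempty _ ho ⟨s, by simp⟩
    exact ⟨g, hg', fun χ hχ => Set.mem_iInter₂.1 hg χ hχ⟩
  choose h hh' hχ using hex
  refine ⟨S, h, hh', fun M hMo hhM => ?_⟩
  by_contra hM
  -- This `χ` kills every `h s`, hence `S`, on which it has the same values, hence all of `H`.
  obtain ⟨χ, ho, hle, hne⟩ := hH.exists_monoidHom hMo hM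
  refine hne (eq_top_iff.2 fun x _ => ?_)
  have hcl : Subgroup.closure (S : Set H) ≤ χ.ker := (Subgroup.closure_le _).2 fun s hs =>
    MonoidHom.mem_ker.2 ((hχ ⟨s, hs⟩ χ ho).symm.trans (MonoidHom.mem_ker.1 (hle (hhM ⟨s, hs⟩))))
  exact (Subgroup.isClosed_of_isOpen _ ho).closure_subset_iff.2 hcl (hS x)

end Generators

/-! ### Measures as functionals on locally constant functions -/

section Integral

variable {k : Type*} [Field k] {X : Type*} [TopologicalSpace X]
  {V : Type*} [AddCommGroup V] [Module k V]

theorem Meas.apply_bot (μ : Meas k X V) : μ.1 ⊥ = 0 := by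
  simpa using μ.2 ⊥ ⊥ disjoint_bot_left

theorem Meas.apply_finset_sup (μ : Meas k X V) {T : Type*} (F : Finset T) (A : T → Clopens X)
    (hA : (F : Set T).PairwiseDisjoint A) : μ.1 (F.sup A) = ∑ t ∈ F, μ.1 (A t) := by
  classical
  induction F using Finset.induction_on with
  | empty => simpa using Meas.apply_bot μ
  | insert t F ht ih =>
    rw [Finset.coe_insert] at hA
    rw [Finset.sup_insert, Finset.sum_insert ht, ← ih (hA.subset (Set.subset_insert _ _))]
    refine μ.2 _ _ (Finset.disjoint_sup_right.2 fun s hs => ?_)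
    exact hA (Set.mem_insert _ _) (Set.mem_insert_of_mem _ hs) (by rintro rfl; exact ht hs)

/-- The fibre of a locally constant function, as a clopen set. -/
def fiber {T : Type*} (ψ : LocallyConstant X T) (t : T) : Clopens X :=
  ⟨ψ ⁻¹' {t}, ψ.isLocallyConstant.isClopen_fiber t⟩

theorem mem_fiber {T : Type*} (ψ : LocallyConstant X T) (t : T) (x : X) :
    x ∈ fiber ψ t ↔ ψ x = t := Iff.rfl

theorem pairwiseDisjoint_fiber {T : Type*} (ψ : LocallyConstant X T) (s : Set T) :
    s.PairwiseDisjoint (fiber ψ) := by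
  intro a _ b _ hab
  rw [Function.onFun, ← Clopens.coe_disjoint]
  exact Disjoint.preimage ψ (Set.disjoint_singleton.2 hab)

theorem Meas.apply_fiber_map (μ : Meas k X V) {T W : Type*} [DecidableEq W]
    (ψ : LocallyConstant X T) (g : T → W) (F : Finset T) (hF : ∀ x, ψ x ∈ F) (c : W) :
    μ.1 (fiber (ψ.map g) c) = ∑ t ∈ F with g t = c, μ.1 (fiber ψ t) := by
  rw [← Meas.apply_finset_sup μ _ _ (pairwiseDisjoint_fiber ψ _)]
  refine congrArg μ.1 (Clopens.ext (Set.ext fun x => ?_))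
  rw [Clopens.coe_finset_sup]
  simp [mem_fiber, hF]

theorem charFn_sup (R : Type*) [Ring R] {A B : Clopens X} (h : Disjoint A B) :
    LocallyConstant.charFn R (A ⊔ B).isClopen =
      LocallyConstant.charFn R A.isClopen + LocallyConstant.charFn R B.isClopen := by
  ext x
  have h' := Clopens.coe_disjoint.2 h
  exact congrFun (Set.indicator_union_of_disjoint h' 1) x

/-- The measure defined by a linear functional on locally constant functions. -/
noncomputable def Meas.ofFunctional (L : LocallyConstant X k →ₗ[k] V) : Meas k X V :=
  ⟨fun A => L (LocallyConstant.charFn k A.isClopen), fun A B h => by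
    simp only [charFn_sup k h, map_add]⟩

variable [CompactSpace X]

/-- The range of a locally constant function on a compact space, as a finite set. -/
noncomputable def rangeFinset {T : Type*} (ψ : LocallyConstant X T) : Finset T :=
  ψ.range_finite.toFinset

theorem mem_rangeFinset {T : Type*} (ψ : LocallyConstant X T) (x : X) : ψ x ∈ rangeFinset ψ := by
  simp [rangeFinset]

/-- The integral of a locally constant function against a finitely additive measure. -/
noncomputable def integralAux (μ : Meas k X V) (φ : LocallyConstant X k) : V :=
  ∑ c ∈ rangeFinset φ, c • μ.1 (fiber φ c)

/-- Allows several functions to be integrated over the fibres of one common refinement, whence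
additivity of the integral. -/
theorem integralAux_map (μ : Meas k X V) {T : Type*} (ψ : LocallyConstant X T) (g : T → k)
    (F : Finset T) (hF : ∀ x, ψ x ∈ F) :
    integralAux μ (ψ.map g) = ∑ t ∈ F, g t • μ.1 (fiber ψ t) := by
  classical
  have h1 : rangeFinset (ψ.map g) ⊆ F.image g := by
    intro c hc
    obtain ⟨x, rfl⟩ := (Set.Finite.mem_toFinset _).1 hc
    exact Finset.mem_image_of_mem g (hF x)
  rw [integralAux, Finset.sum_subset h1, ← Finset.sum_fiberwise_of_maps_to
    (g := g) (t := F.image g) fun t ht => Finset.mem_image_of_mem g ht]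
  · refine Finset.sum_congr rfl fun c _ => ?_
    rw [Meas.apply_fiber_map μ ψ g F hF, Finset.smul_sum]
    refine Finset.sum_congr rfl fun t ht => ?_
    rw [(Finset.mem_filter.1 ht).2]
  · intro c _ hc
    have : fiber (ψ.map g) c = ⊥ := by
      ext x
      simp only [Clopens.coe_bot, Set.mem_empty_iff_false, iff_false]
      rintro rfl
      exact hc (mem_rangeFinset _ x)
    rw [this, Meas.apply_bot μ, smul_zero]

/-- The integral against a finitely additive measure, as a linear functional on locally constant
functions. -/
noncomputable def integral (μ : Meas k X V) : LocallyConstant X k →ₗ[k] V where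
  toFun := integralAux μ
  map_add' φ φ' := by
    let ψ : LocallyConstant X (k × k) := ⟨fun x => (φ x, φ' x),
      φ.isLocallyConstant.prodMk φ'.isLocallyConstant⟩
    have h0 := integralAux_map μ ψ (fun t => t.1 + t.2) _ (mem_rangeFinset ψ)
    have h1 := integralAux_map μ ψ Prod.fst _ (mem_rangeFinset ψ)
    have h2 := integralAux_map μ ψ Prod.snd _ (mem_rangeFinset ψ)
    simp only [add_smul, Finset.sum_add_distrib] at h0
    rw [← h1, ← h2] at h0
    exact h0
  map_smul' c φ := by
    have h0 := integralAux_map μ φ (fun t => c • t) _ (mem_rangeFinset φ)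
    simp only [smul_assoc, ← Finset.smul_sum] at h0
    exact h0

theorem integral_charFn (μ : Meas k X V) (A : Clopens X) :
    integral μ (LocallyConstant.charFn k A.isClopen) = μ.1 A := by
  classical
  have h := integralAux_map μ (LocallyConstant.charFn k A.isClopen) id {0, 1} fun x => by
    by_cases hx : x ∈ (A : Set X) <;> simp [LocallyConstant.coe_charFn, hx]
  refine h.trans ?_
  rw [Finset.sum_pair zero_ne_one]
  change (0 : k) • _ + (1 : k) • _ = _
  rw [zero_smul, one_smul, zero_add]
  refine congrArg μ.1 (Clopens.ext (Set.ext fun x => ?_))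
  exact LocallyConstant.charFn_eq_one k x A.isClopen

end Integral

theorem exists_comp_eq_of_ker_le_ker {k : Type*} [Field k] {U V W : Type*} [AddCommGroup U]
    [Module k U] [AddCommGroup V] [Module k V] [AddCommGroup W] [Module k W]
    (f : U →ₗ[k] V) (g : U →ₗ[k] W) (h : LinearMap.ker f ≤ LinearMap.ker g) :
    ∃ l : V →ₗ[k] W, l ∘ₗ f = g := by
  obtain ⟨r, hr⟩ := LinearMap.exists_leftInverse_of_injective
    ((LinearMap.ker f).liftQ f le_rfl) (Submodule.ker_liftQ_eq_bot _ _ _ le_rfl)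
  refine ⟨(LinearMap.ker f).liftQ g h ∘ₗ r, ?_⟩
  ext x
  have := LinearMap.congr_fun hr (Submodule.Quotient.mk x)
  simp only [LinearMap.comp_apply, Submodule.liftQ_apply, LinearMap.id_apply] at this
  simp [this]

/-! ### Decomposition of a measure along generators -/

section Translation

variable {H : Type*} [Group H] [TopologicalSpace H] [IsTopologicalGroup H]

/-- The right stabilizer of `φ` is an open subgroup containing every `h i`. -/
theorem apply_eq_of_forall_apply_mul_eq [CompactSpace H] [TotallyDisconnectedSpace H]
    {ι T : Type*} {h : ι → H}
    (hh : ∀ M : Subgroup H, IsOpen (M : Set H) → (∀ i, h i ∈ M) → M = ⊤)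
    {φ : H → T} (hφ : IsLocallyConstant φ) (hi : ∀ i y, φ (y * h i) = φ y) (y : H) :
    φ y = φ 1 := by
  let M : Subgroup H :=
    { carrier := {g | ∀ y, φ (y * g) = φ y}
      one_mem' := by simp
      mul_mem' := fun {a b} ha hb y => by rw [← mul_assoc, hb, ha]
      inv_mem' := fun {a} ha y => by rw [← ha, inv_mul_cancel_right] }
  obtain ⟨N, hN⟩ := exists_openNormalSubgroup_forall_mul_eq hφ
  have hMo : IsOpen (M : Set H) := by
    refine Subgroup.isOpen_mono (H₁ := N.toSubgroup) (fun n hn y => ?_) N.isOpen'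
    have := hN (y * n * y⁻¹) (Subgroup.Normal.conj_mem
      (inferInstanceAs N.toSubgroup.Normal) _ hn y) y
    rwa [inv_mul_cancel_right] at this
  have hy : y ∈ M := hh M hMo hi ▸ Subgroup.mem_top y
  simpa using hy 1

variable {k : Type*} [Field k] {V : Type*} [AddCommGroup V] [Module k V]

/-- If `h` is a finite family of topological generators of `H`, every measure on `H` is the sum of
a point measure at `1` and of differences of right translates by members of the family. -/
theorem Meas.exists_eq_pointMeas_add_sum [CompactSpace H] [TotallyDisconnectedSpace H]
    {ι : Type*} [Fintype ι] {h : ι → H}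
    (hh : ∀ M : Subgroup H, IsOpen (M : Set H) → (∀ i, h i ∈ M) → M = ⊤) (μ : Meas k H V) :
    ∃ ν : ι → Meas k H V, μ = pointMeas 1 (μ.1 ⊤) +
      ∑ i, (pushforward (ContinuousMap.mulRight (h i)) (ν i) - ν i) := by
  classical
  let Δ : LocallyConstant H k →ₗ[k] (ι → LocallyConstant H k) := LinearMap.pi fun i =>
    LocallyConstant.comapₗ k (ContinuousMap.mulRight (h i)) - LinearMap.id
  -- The kernel of `Δ` consists of constants, on which a measure of total mass zero vanishes. The
  -- components of `l` yield the measures `ν i`.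
  obtain ⟨l, hl⟩ := exists_comp_eq_of_ker_le_ker Δ (integral (μ - pointMeas 1 (μ.1 ⊤))) (by
    intro φ hφ
    have hc : φ = φ 1 • LocallyConstant.charFn k (⊤ : Clopens H).isClopen := by
      ext y
      refine (apply_eq_of_forall_apply_mul_eq hh φ.isLocallyConstant (fun i y => ?_) y).trans ?_
      · have := LocallyConstant.congr_fun (congrFun (LinearMap.mem_ker.1 hφ) i) y
        exact sub_eq_zero.1 this
      · simp [LocallyConstant.coe_charFn]
    rw [LinearMap.mem_ker, hc, map_smul, integral_charFn]
    simp [pointMeas, show (1 : H) ∈ (⊤ : Clopens H) from trivial])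
  refine ⟨fun i => Meas.ofFunctional (l ∘ₗ LinearMap.single k (fun _ : ι => LocallyConstant H k) i), ?_⟩
  rw [← sub_eq_iff_eq_add']
  ext A
  rw [← integral_charFn, ← hl, LinearMap.comp_apply, ← LinearMap.sum_single_apply (φ := fun _ : ι => LocallyConstant H k) (Δ _),
    map_sum]
  simp only [AddSubmonoidClass.coe_finsetSum, Finset.sum_apply]
  refine Finset.sum_congr rfl fun i _ => ?_
  rw [show Δ (LocallyConstant.charFn k A.isClopen) i =
    LocallyConstant.charFn k (clopenPreimage (ContinuousMap.mulRight (h i)) A).isClopen -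
      LocallyConstant.charFn k A.isClopen from rfl]
  rw [Pi.single_sub, map_sub]
  rfl

end Translation

/-! ### Series over words as measures -/

section WordMeas

variable {p : ℕ} [Fact p.Prime] {k : Type*} [Field k] [CharP k p] {H : Type*} [Group H] [TopologicalSpace H] [IsTopologicalGroup H]
  [CompactSpace H] [TotallyDisconnectedSpace H] {ι : Type*} [Finite ι]

variable (k) in
/-- The iterated differences at `1` of the characteristic function of a clopen set, along all
words in a finite family of elements of a pro-`p`-group. -/
noncomputable def wordCoeff (hH : IsProP p H) (h : ι → H)
    (A : Clopens H) : List ι →₀ k :=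
  Finsupp.ofSupportFinite
    (fun w => ZMod.castHom (dvd_refl p) k
      (augWord h w (LocallyConstant.charFn (ZMod p) A.isClopen))) (by
    obtain ⟨n, hn⟩ := exists_forall_augWord_eq_zero hH h
      (LocallyConstant.charFn (ZMod p) A.isClopen).isLocallyConstant
    refine (List.finite_length_lt ι n).subset fun w hw => ?_
    by_contra hlt
    exact hw ((congrArg _ (hn w (not_lt.1 hlt))).trans (map_zero _)))

theorem wordCoeff_apply (hH : IsProP p H) (h : ι → H) (A : Clopens H) (w : List ι) :
    wordCoeff k hH h A w = ZMod.castHom (dvd_refl p) k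
      (augWord h w (LocallyConstant.charFn (ZMod p) A.isClopen)) := rfl

theorem wordCoeff_sup (hH : IsProP p H) (h : ι → H) {A B : Clopens H} (hAB : Disjoint A B) :
    wordCoeff k hH h (A ⊔ B) = wordCoeff k hH h A + wordCoeff k hH h B := by
  ext w
  rw [Finsupp.add_apply, wordCoeff_apply, wordCoeff_apply, wordCoeff_apply, charFn_sup _ hAB,
    LocallyConstant.coe_add, map_add, map_add]

-- Words are split by their first letter, whose difference replaces `A` by its preimage under left
-- translation.
open Classical in
theorem wordCoeff_eq [Fintype ι] (hH : IsProP p H) (h : ι → H) (A : Clopens H) :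
    wordCoeff k hH h A = Finsupp.single [] (if (1 : H) ∈ A then (1 : k) else 0) +
      ∑ i, Finsupp.mapDomain (List.cons i)
        (wordCoeff k hH h (clopenPreimage (ContinuousMap.mulLeft (h i)) A) -
          wordCoeff k hH h A) := by
  ext w
  rw [Finsupp.add_apply, Finsupp.finsetSum_apply]
  cases w with
  | nil =>
    rw [Finset.sum_eq_zero fun i _ => Finsupp.mapDomain_of_notMem_range _ _ (by simp), wordCoeff_apply]
    by_cases h1 : (1 : H) ∈ A <;>
      simp [augWord, LocallyConstant.coe_charFn, h1]
  | cons j w =>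
    rw [Finset.sum_eq_single j (fun i _ hij => Finsupp.mapDomain_of_notMem_range _ _ (by simp [hij]))
      (by simp), Finsupp.mapDomain_apply List.cons_injective, Finsupp.sub_apply, wordCoeff_apply,
      wordCoeff_apply, wordCoeff_apply, ← map_sub, ← map_sub,
      Finsupp.single_eq_of_ne (by simp), zero_add]
    rfl

variable {V : Type*} [AddCommGroup V] [Module k V]

/-- The measure `∑ (h i₁ - 1) ⋯ (h iₙ - 1) e(iₙ, …, i₁)`, the sum being over all words. -/
noncomputable def wordMeas (hH : IsProP p H) (h : ι → H) (e : List ι → V) : Meas k H V :=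
  ⟨fun A => Finsupp.linearCombination k e (wordCoeff k hH h A), fun A B hAB => by
    simp only [wordCoeff_sup hH h hAB, map_add]⟩

theorem wordMeas_apply (hH : IsProP p H) (h : ι → H) (e : List ι → V) (A : Clopens H) :
    (wordMeas (k := k) hH h e).1 A = Finsupp.linearCombination k e (wordCoeff k hH h A) := rfl

theorem wordMeas_eq [Fintype ι] (hH : IsProP p H) (h : ι → H) (e : List ι → V) :
    wordMeas (k := k) hH h e = pointMeas 1 (e []) +
      ∑ i, (pushforward (ContinuousMap.mulLeft (h i)) (wordMeas hH h fun w => e (i :: w)) -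
        wordMeas hH h fun w => e (i :: w)) := by
  classical
  ext A
  simp only [Submodule.coe_add, AddSubmonoidClass.coe_finsetSum, Pi.add_apply, Finset.sum_apply]
  rw [wordMeas_apply, wordCoeff_eq, map_add, map_sum]
  congr 1
  · by_cases h1 : (1 : H) ∈ A <;> simp [pointMeas, h1]
  · refine Finset.sum_congr rfl fun i _ => ?_
    rw [Finsupp.linearCombination_mapDomain, map_sub]
    rfl

theorem wordMeas_sum [Fintype ι] (hH : IsProP p H) (h : ι → H) (T : ι → V →ₗ[k] V)
    (e : ι → List ι → V) :
    wordMeas (k := k) hH h (fun w => ∑ i, T i (e i w)) =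
      ∑ i, mapCoeff (T i) (wordMeas hH h (e i)) := by
  ext A
  simp only [AddSubmonoidClass.coe_finsetSum, Finset.sum_apply]
  rw [wordMeas_apply, Finsupp.linearCombination_apply, Finsupp.sum]
  simp only [Finset.smul_sum]
  rw [Finset.sum_comm]
  refine Finset.sum_congr rfl fun i _ => ?_
  change _ = T i (Finsupp.linearCombination k (e i) _)
  rw [Finsupp.linearCombination_apply, Finsupp.sum, map_sum]
  simp only [map_smul]

end WordMeas

/-! ### Nakayama's lemma and recovery of the contraaction -/

namespace HContra

variable {k : Type w} [Field k] {H : Type u} [Group H] [TopologicalSpace H] [IsTopologicalGroup H]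

/-- Contraassociativity on {g} × H: a left translation passes to the coefficients. -/
theorem π_pushforward_mulLeft (Q : HContra.{w, u, v} k H) (g : H) (μ : Meas k H Q.carrier) :
    Q.π (pushforward (ContinuousMap.mulLeft g) μ) =
      Q.π (mapCoeff (Q.π ∘ₗ pointMeas g) μ) := by
  have key := Q.contraassoc
    (pushforward ((ContinuousMap.const H g).prodMk (ContinuousMap.id H)) μ)
  refine key.trans ?_
  congr 1
  ext B
  change Q.π _ = Q.π _
  congr 1
  ext A
  change μ.1 _ = @ite _ _ (Classical.propDecidable _) _ _
  split_ifs with hg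
  · refine congrArg μ.1 (Clopens.ext (Set.ext fun y => ?_))
    change (g ∈ A ∧ y ∈ B) ↔ y ∈ B
    simp [hg]
  · rw [← Meas.apply_bot μ]
    refine congrArg μ.1 (Clopens.ext (Set.ext fun y => ?_))
    change (g ∈ A ∧ y ∈ B) ↔ False
    simp [hg]

/-- Contraassociativity on H × {g}: a right translation comes out of `π`. -/
theorem π_pushforward_mulRight (Q : HContra.{w, u, v} k H) (g : H) (μ : Meas k H Q.carrier) :
    Q.π (pushforward (ContinuousMap.mulRight g) μ) = Q.π (pointMeas g (Q.π μ)) := by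
  have key := Q.contraassoc
    (pushforward ((ContinuousMap.id H).prodMk (ContinuousMap.const H g)) μ)
  refine key.trans ?_
  congr 1
  ext B
  change Q.π _ = @ite _ _ (Classical.propDecidable _) _ _
  split_ifs with hg
  · congr 1
    ext A
    change μ.1 _ = μ.1 _
    refine congrArg μ.1 (Clopens.ext (Set.ext fun y => ?_))
    change (y ∈ A ∧ g ∈ B) ↔ y ∈ A
    simp [hg]
  · rw [← map_zero Q.π]
    congr 1
    ext A
    change μ.1 _ = 0
    rw [← Meas.apply_bot μ]
    refine congrArg μ.1 (Clopens.ext (Set.ext fun y => ?_))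
    change (y ∈ A ∧ g ∈ B) ↔ False
    simp [hg]

variable [CompactSpace H] [TotallyDisconnectedSpace H]

/-- A Nakayama-type lemma: in a contramodule over a pro-`p`-group, an element which can be
expanded indefinitely in terms of products of differences `h i - 1` vanishes. -/
theorem eq_zero_of_forall_eq_sum {p : ℕ} [Fact p.Prime] [CharP k p] (hH : IsProP p H)
    (Q : HContra.{w, u, v} k H) {ι : Type*} [Fintype ι] (h : ι → H) (e : List ι → Q.carrier)
    (he : ∀ w, e w = ∑ i, (Q.π (pointMeas (h i) (e (i :: w))) - e (i :: w))) :
    e [] = 0 := by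
  let T : ι → Q.carrier →ₗ[k] Q.carrier := fun i => Q.π ∘ₗ pointMeas (h i) - LinearMap.id
  have h1 := congrArg Q.π (wordMeas_eq (k := k) hH h e)
  have h2 := congrArg Q.π (wordMeas_sum hH h T fun i w => e (i :: w))
  rw [show (fun w => ∑ i, T i (e (i :: w))) = e from funext fun w => (he w).symm] at h2
  rw [map_add, Q.contraunit, map_sum] at h1
  rw [map_sum] at h2
  rw [h2] at h1
  -- Under `π`, applying `T i` to coefficients equals taking the left difference by `h i`, so `h1`
  -- takes the form x = e [] + x.
  have h3 : ∀ i, Q.π (mapCoeff (T i) (wordMeas hH h fun w => e (i :: w))) =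
      Q.π (pushforward (ContinuousMap.mulLeft (h i)) (wordMeas hH h fun w => e (i :: w)) -
        wordMeas hH h fun w => e (i :: w)) := by
    intro i
    rw [map_sub, π_pushforward_mulLeft, ← map_sub]
    rfl
  simp only [h3] at h1
  exact right_eq_add.1 h1

theorem comm_of_forall_comm_action {p : ℕ} [Fact p.Prime] [CharP k p] (hH : IsProP p H)
    (hfg : IsTopFG H) {H' : Subgroup H} (hd : Dense (H' : Set H)) {P Q : HContra.{w, u, v} k H}
    (f : P.carrier →ₗ[k] Q.carrier) (hf : ∀ h ∈ H', ∀ a, f (P.action h a) = Q.action h (f a))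
    (μ : Meas k H P.carrier) : f (P.π μ) = Q.π (mapCoeff f μ) := by
  obtain ⟨S, h, hh', hh⟩ := exists_generators_mem_of_dense hH hfg hd
  let δ : Meas k H P.carrier →ₗ[k] Q.carrier := f ∘ₗ P.π - Q.π ∘ₗ mapCoeff f
  have hf' : ∀ i a, f (P.π (pointMeas (h i) a)) = Q.π (pointMeas (h i) (f a)) := by
    intro i a
    -- The inverse cancels the one in the definition of `action`.
    have := hf (h i)⁻¹ (H'.inv_mem (hh' i)) a
    simpa [action] using this
  have hδ : ∀ ν : Meas k H P.carrier, ∃ ν' : S → Meas k H P.carrier,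
      δ ν = ∑ i, (Q.π (pointMeas (h i) (δ (ν' i))) - δ (ν' i)) := by
    intro ν
    obtain ⟨ν', hν'⟩ := Meas.exists_eq_pointMeas_add_sum hh ν
    refine ⟨ν', ?_⟩
    have h1 : δ (pointMeas 1 (ν.1 ⊤)) = 0 := by
      simp [δ, mapCoeff_pointMeas, contraunit]
    have h2 : ∀ i, δ (pushforward (ContinuousMap.mulRight (h i)) (ν' i)) =
        Q.π (pointMeas (h i) (δ (ν' i))) := by
      intro i
      change f (P.π _) - Q.π (pushforward (ContinuousMap.mulRight (h i)) (mapCoeff f (ν' i))) =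
        Q.π (pointMeas (h i) (f (P.π (ν' i)) - Q.π (mapCoeff f (ν' i))))
      rw [π_pushforward_mulRight, π_pushforward_mulRight, hf', map_sub, map_sub]
    conv_lhs => rw [hν']
    rw [map_add, h1, zero_add, map_sum]
    exact Finset.sum_congr rfl fun i _ => by rw [map_sub, h2]
  choose s hs using hδ
  -- Iterated decomposition: `m [] = μ` and `m (i :: w) = s (m w) i`.
  let m : List S → Meas k H P.carrier := List.foldr (fun i ν => s ν i) μ
  exact sub_eq_zero.1 (eq_zero_of_forall_eq_sum hH Q h (fun w => δ (m w)) fun w => hs (m w))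

end HContra

end Contra

open Contra HContra in
theorem mainTheorem12 (p : ℕ) (hp : p.Prime) (k : Type w) [Field k] [CharP k p]
    (H : Type u) [Group H] [TopologicalSpace H] [IsTopologicalGroup H]
    [CompactSpace H] [T2Space H] [TotallyDisconnectedSpace H]
    (hH : Contra.IsProP p H) (hfg : Contra.IsTopFG H) :
    ((Contra.HContra.forgetToRep.{w, u, v} k H).Full ∧
      (Contra.HContra.forgetToRep.{w, u, v} k H).Faithful) ∧
    ∀ H' : Subgroup H, Dense (H' : Set H) →
      (Contra.HContra.forgetToSubgroupRep.{w, u, v} k H').Full ∧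
        (Contra.HContra.forgetToSubgroupRep.{w, u, v} k H').Faithful := by
  have : Fact p.Prime := ⟨hp⟩
  have hfaithful : (forgetToRep.{w, u, v} k H).Faithful := ⟨fun {P Q} f g hfg => by
    refine HContra.Hom.ext (LinearMap.ext fun a => ?_)
    exact congrArg (fun F : (forgetToRep k H).obj P ⟶ (forgetToRep k H).obj Q => F.hom a) hfg⟩
  refine ⟨⟨⟨fun {P Q} F => ?_⟩, hfaithful⟩, fun H' hd => ⟨⟨fun {P Q} F => ?_⟩, ?_⟩⟩
  · refine ⟨⟨F.hom.toLinearMap, comm_of_forall_comm_action hH hfg (H' := ⊤) (by simp) _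
      fun h _ a => Rep.hom_comm_apply F h a⟩, ?_⟩
    ext a
    rfl
  · refine ⟨⟨F.hom.toLinearMap, comm_of_forall_comm_action hH hfg hd _
      fun h hh a => Rep.hom_comm_apply F ⟨h, hh⟩ a⟩, ?_⟩
    ext a
    rfl
  · exact inferInstanceAs (forgetToRep k H ⋙ Rep.resFunctor H'.subtype).Faithful
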